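/- Let $r\ge 0$, let $f\in\mathbb{C}[z_1^{\pm1},\dots,z_r^{\pm1}]$ be a Laurent polynomial, let $\mathrm{Log}:(\mathbb{C}^*)^r\to\mathbb{R}^r$, $\mathrm{Log}(\mathbf z)=(\log|z_1|,\dots,\log|z_r|)$, and let $\mathcal{A}_f=\mathrm{Log}(\{\mathbf z\in(\mathbb{C}^*)^r: f(\mathbf z)=0\})$ be the amoeba of $f$. Let $\Delta(f)\subset\mathbb{R}^r$ be the Newton polytope of $f$, i.e. the convex hull of the exponent vectors of the monomials which appear in $f$. For a positive integer $n$ put $$f_n(\mathbf z)=\prod_{k_1=0}^{n-1}\cdots\prod_{k_r=0}^{n-1} f(e^{2\pi i k_1/n}z_1,\dots,e^{2\pi i k_r/n}z_r).$$ For a Laurent polynomial $g=\sum_j m_j$, written as the sum of its (nonzero) monomials, and $\mathbf a\in\mathbb{R}^r$, let $g\{\mathbf a\}$ be the list of the positive numbers $|m_j(\mathrm{Log}^{-1}(\mathbf a))|$. A list of positive numbers is lopsided if one of the numbers is greater than the sum of all the others; if $g\{\mathbf a\}$ is lopsided, the corresponding monomial of $g$ is said to dominate at $\mathbf a$. For $\mathbf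 a\in\mathbb{R}^r\setminus\mathcal{A}_f$, the index $\mathrm{ind}(\mathbf a)=(k_1,\dots,k_r)\in\mathbb{Z}^r$ is defined as follows: choose $\boldsymbol\zeta\in\mathrm{Log}^{-1}(\mathbf a)$, let $f^{\boldsymbol\zeta,i}(z)=f(\zeta_1,\dots,\zeta_{i-1},z,\zeta_{i+1},\dots,\zeta_r)$, and let $k_i$ be the number of roots, counted with multiplicity, of $f^{\boldsymbol\zeta,i}$ in $\{0<|z|<e^{a_i}\}$ plus the smallest exponent of $z$ which appears in $f^{\boldsymbol\zeta,i}$. Let $\mathbf a\in\mathbb{R}^r\setminus\mathcal{A}_f$. Then $\mathrm{ind}(\mathbf a)$ does not depend on the choice of $\boldsymbol\zeta\in\mathrm{Log}^{-1}(\mathbf a)$. Moreover, write $\mathrm{ind}(\mathbf a)=\mathbf k$; if $n$ is a positive integer such that $f_n\{\mathbf a\}$ is lopsided, then $\mathbf k\in\Delta(f)$ and the monomial of $f_n$ which dominates at $\mathbf a$ has exponent vector $n^r\mathbf k$. -/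

import Mathlib

namespace LopsidedAmoeba

/-- Laurent polynomials `ℂ[z₁, z₁⁻¹, …, z_r, z_r⁻¹]`: the group algebra of the group `ℤ^r`
of exponent vectors. -/
abbrev Laurent (r : ℕ) : Type := AddMonoidAlgebra ℂ (Fin r → ℤ)

variable {r : ℕ}

/-- The value `f(z)` at a point `z` of the torus `(ℂ*)^r`. -/
noncomputable def eval (z : Fin r → ℂˣ) (f : Laurent r) : ℂ :=
  f.coeff.sum fun e c => c * ∏ i, (z i : ℂ) ^ e i

/-- `Log(z) = (log |z₁|, …, log |z_r|)`. -/
noncomputable def Log (z : Fin r → ℂˣ) : Fin r → ℝ :=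
  fun i => Real.log ‖(z i : ℂ)‖

/-- The amoeba of `f`: the image under `Log` of the zero locus of `f` in `(ℂ*)^r`. -/
def amoeba (f : Laurent r) : Set (Fin r → ℝ) :=
  Log '' {z | eval z f = 0}

/-- The Newton polytope: the convex hull of the exponent vectors of the monomials of `f`. -/
def newtonPolytope (f : Laurent r) : Set (Fin r → ℝ) :=
  convexHull ℝ ((fun e i => (e i : ℝ)) '' (f.coeff.support : Set (Fin r → ℤ)))

/-- The Laurent polynomial `f(u₁ z₁, …, u_r z_r)`. -/
noncomputable def rescale (u : Fin r → ℂˣ) (f : Laurent r) : Laurent r :=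
  f.coeff.sum fun e c => AddMonoidAlgebra.single e (c * ∏ i, (u i : ℂ) ^ e i)

/-- The root of unity `e^{2πik/n}`. -/
noncomputable def rootOfUnity (n k : ℕ) : ℂˣ :=
  Units.mk0 (Complex.exp (2 * Real.pi * Complex.I * k / n)) (Complex.exp_ne_zero _)

/-- `f_n(z) = ∏_{k₁=0}^{n-1} ⋯ ∏_{k_r=0}^{n-1} f(e^{2πik₁/n} z₁, …, e^{2πik_r/n} z_r)`. -/
noncomputable def cyclicResultant (n : ℕ) (f : Laurent r) : Laurent r :=
  ∏ k : Fin r → Fin n, rescale (fun i => rootOfUnity n (k i)) f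

/-- `|m(z)|` for the monomial `m` of `g` with exponent vector `e` and any `z` with
`Log z = a`, that is, `|z_i| = exp (a i)`. -/
noncomputable def monomialAbs (g : Laurent r) (a : Fin r → ℝ) (e : Fin r → ℤ) : ℝ :=
  ‖g.coeff e‖ * ∏ i, Real.exp (a i) ^ e i

/-- The list `g{a}` of the absolute values at `a` of the monomials which appear in `g`. -/
noncomputable def absList (g : Laurent r) (a : Fin r → ℝ) : Multiset ℝ :=
  g.coeff.support.val.map (monomialAbs g a)

/-- A list of numbers is lopsided if one of them is greater than the sum of all the others. -/
def IsLopsided (S : Multiset ℝ) : Prop :=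
  ∃ b ∈ S, (S.erase b).sum < b

/-- The monomial of `g` with exponent vector `e` appears in `g` and dominates at `a`:
its absolute value is greater than the sum of those of all the other monomials of `g`. -/
def IsDominant (g : Laurent r) (a : Fin r → ℝ) (e : Fin r → ℤ) : Prop :=
  e ∈ g.coeff.support ∧
    ∑ e' ∈ g.coeff.support.erase e, monomialAbs g a e' < monomialAbs g a e

/-- The one-variable Laurent polynomial `f(ζ₁, …, ζ_{i-1}, z, ζ_{i+1}, …, ζ_r)` in `z`. -/
noncomputable def restrict (f : Laurent r) (ζ : Fin r → ℂˣ) (i : Fin r) :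
    LaurentPolynomial ℂ :=
  f.coeff.sum fun e c =>
    AddMonoidAlgebra.single (e i) (c * ∏ j ∈ Finset.univ.erase i, (ζ j : ℂ) ^ e j)

/-- The smallest exponent which appears in `g` (and `0` if `g = 0`). -/
noncomputable def minDeg (g : LaurentPolynomial ℂ) : ℤ :=
  if h : g.coeff.support.Nonempty then g.coeff.support.min' h else 0

/-- The polynomial `z ^ (-minDeg g) * g(z)`. -/
noncomputable def numerator (g : LaurentPolynomial ℂ) : Polynomial ℂ :=
  g.coeff.sum fun e c => Polynomial.monomial (e - minDeg g).toNat c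

/-- The number of roots of `g`, with multiplicity, in `{0 < |z| < ρ}`. -/
noncomputable def rootCount (g : LaurentPolynomial ℂ) (ρ : ℝ) : ℕ :=
  Multiset.card (Multiset.filter (fun z : ℂ => 0 < ‖z‖ ∧ ‖z‖ < ρ) (numerator g).roots)

/-- The index of `f` computed at the point `ζ` of the torus: its `i`-th coordinate is the number
of roots of `f(ζ₁, …, z, …, ζ_r)` in `{0 < |z| < |ζ_i|}` plus the smallest exponent of that
Laurent polynomial, i.e. the number of roots minus the number of poles in `{|z| < |ζ_i|}`. -/
noncomputable def indexAt (f : Laurent r) (ζ : Fin r → ℂˣ) : Fin r → ℤ :=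
  fun i => (rootCount (restrict f ζ i) ‖(ζ i : ℂ)‖ : ℤ) + minDeg (restrict f ζ i)

/-- The point `(e^{a₁}, …, e^{a_r})` of `Log⁻¹(a)`. -/
noncomputable def expPoint (a : Fin r → ℝ) : Fin r → ℂˣ :=
  fun i => Units.mk0 (Complex.exp (a i)) (Complex.exp_ne_zero _)

/-- The index `ind(a)` of a point `a` of the amoeba complement, computed at the positive real
point of `Log⁻¹(a)`. -/
noncomputable def ind (f : Laurent r) (a : Fin r → ℝ) : Fin r → ℤ :=
  indexAt f (expPoint a)

end LopsidedAmoeba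

open Complex intervalIntegral
namespace LopsidedAmoeba

/-! The `i`-th index is a winding number: the mean over the circle through `ζ` in the `i`-th
coordinate of `z_i ∂_i f / f`. The argument principle (`winding_eq_indexAt`) identifies this mean
with roots plus smallest exponent, so it is an integer. It also varies continuously as long as
nothing vanishes on the torus over `a`, hence it is invariant under deformation
(`average_constant`).

Three consequences give the theorem. Moving the base point within the connected torus shows
independence of `ζ` (`winding_constant_on_torus`). Logarithmic derivatives add over products and
each of the `n ^ r` factors of `f_n` is `f` at a rotated torus point, so the winding of `f_n` is `n
^ r` times that of `f` (`winding_cyclicResultant`). Shrinking the non-dominant monomials to zero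
shows that a dominant exponent equals the winding (`winding_of_isDominant`). Comparing the last two
gives the exponent `n ^ r k`; it is a sum of `n ^ r` exponents of `f`, so `k` is their average and
lies in the Newton polytope. -/

/-- The value at a point of `ℂ^r` (meaningful when all coordinates are nonzero). -/
noncomputable def value {r : ℕ} (z : Fin r → ℂ) (f : Laurent r) : ℂ :=
  f.coeff.sum fun e c => c * ∏ j, z j ^ e j

/-- The value of the logarithmic derivative `z_i ∂f/∂z_i`. -/
noncomputable def eulerValue {r : ℕ} (i : Fin r) (z : Fin r → ℂ) (f : Laurent r) : ℂ :=
  f.coeff.sum fun e c => (e i : ℂ) * (c * ∏ j, z j ^ e j)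

/-- The point obtained from `z` by rotating its `i`-th coordinate by the angle `t`. -/
noncomputable def rotate {r : ℕ} (i : Fin r) (z : Fin r → ℂ) (t : ℝ) : Fin r → ℂ :=
  Function.update z i (z i * exp (t * I))

/-- The winding number of `f` along the `i`-th coordinate circle through `z`. -/
noncomputable def winding {r : ℕ} (i : Fin r) (z : Fin r → ℂ) (f : Laurent r) : ℂ :=
  (2 * Real.pi : ℂ)⁻¹ *
    ∫ t in (0 : ℝ)..2 * Real.pi, eulerValue i (rotate i z t) f / value (rotate i z t) f

/-! ### The argument principle on a circle centred at the origin -/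

lemma exp_mul_I_sub_ne_zero {w : ℂ} (hw : ‖w‖ ≠ 1) (t : ℝ) : exp (t * I) - w ≠ 0 := by
  intro h
  apply hw
  rw [← sub_eq_zero.1 h, norm_exp_ofReal_mul_I]

/-- Up to the factor `I` this is the integral of `(z - w)⁻¹` over the unit circle: Cauchy's formula
applies for `w` inside, Cauchy's theorem for `w` outside. -/
lemma integral_exp_div_exp_sub {w : ℂ} (hw : ‖w‖ ≠ 1) :
    ∫ t in (0 : ℝ)..2 * Real.pi, exp (t * I) / (exp (t * I) - w) =
      if ‖w‖ < 1 then (2 * Real.pi : ℂ) else 0 := by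
  have key : (∮ z in C(0, 1), (z - w)⁻¹) =
      I * ∫ t in (0 : ℝ)..2 * Real.pi, exp (t * I) / (exp (t * I) - w) := by
    rw [circleIntegral, ← intervalIntegral.integral_const_mul]
    refine intervalIntegral.integral_congr fun t _ => ?_
    simp [circleMap, deriv_circleMap]
    ring
  have hI := I_ne_zero
  split_ifs with h
  · rw [circleIntegral.integral_sub_inv_of_mem_ball (by simpa using h)] at key
    apply mul_left_cancel₀ hI
    rw [← key]; ring
  · have h0 : (∮ z in C(0, 1), (z - w)⁻¹) = 0 := by
      refine DiffContOnCl.circleIntegral_eq_zero zero_le_one ?_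
      refine DifferentiableOn.diffContOnCl fun z hz => ?_
      have hz' : ‖z‖ ≤ 1 := by
        rw [closure_ball _ one_ne_zero] at hz
        simpa using hz
      have : z - w ≠ 0 := fun h' => by
        rw [sub_eq_zero.1 h'] at hz'
        exact h (lt_of_le_of_ne hz' hw)
      exact ((differentiableAt_id.sub_const w).inv this).differentiableWithinAt
    rw [h0] at key
    exact (mul_eq_zero.1 key.symm).resolve_left hI

lemma continuous_exp_div_exp_sub {w : ℂ} (hw : ‖w‖ ≠ 1) :
    Continuous fun t : ℝ => exp (t * I) / (exp (t * I) - w) :=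
  Continuous.div (by fun_prop) (by fun_prop) (exp_mul_I_sub_ne_zero hw)

lemma continuous_and_integral_multiset_sum_exp_div (s : Multiset ℂ) (h : ∀ w ∈ s, ‖w‖ ≠ 1) :
    (Continuous fun t : ℝ => (s.map fun w => exp (t * I) / (exp (t * I) - w)).sum) ∧
    ∫ t in (0 : ℝ)..2 * Real.pi, (s.map fun w => exp (t * I) / (exp (t * I) - w)).sum =
      2 * Real.pi * (s.filter fun w => ‖w‖ < 1).card := by
  induction s using Multiset.induction_on with
  | empty => simp [continuous_const]
  | cons w s ih =>
    obtain ⟨hc, hi⟩ := ih fun x hx => h x (Multiset.mem_cons_of_mem hx)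
    have hw := h w (Multiset.mem_cons_self w s)
    have hcw := continuous_exp_div_exp_sub hw
    simp only [Multiset.map_cons, Multiset.sum_cons]
    refine ⟨hcw.add hc, ?_⟩
    rw [intervalIntegral.integral_add (hcw.intervalIntegrable _ _) (hc.intervalIntegrable _ _), hi,
      integral_exp_div_exp_sub hw, Multiset.filter_cons]
    split_ifs
    · simp; ring
    · simp

/-- The argument principle for a polynomial on the circle through `ζ` centred at the origin. -/
lemma integral_polynomial_logDeriv (P : Polynomial ℂ) (ζ : ℂ) (hζ : ζ ≠ 0)
    (hP : ∀ t : ℝ, P.eval (ζ * exp (t * I)) ≠ 0) :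
    (Continuous fun t : ℝ => ζ * exp (t * I) * P.derivative.eval (ζ * exp (t * I)) /
        P.eval (ζ * exp (t * I))) ∧
    ∫ t in (0 : ℝ)..2 * Real.pi, ζ * exp (t * I) * P.derivative.eval (ζ * exp (t * I)) /
        P.eval (ζ * exp (t * I)) =
      2 * Real.pi * (P.roots.filter fun w => ‖w‖ < ‖ζ‖).card := by
  have hζ' : 0 < ‖ζ‖ := norm_pos_iff.2 hζ
  refine ⟨Continuous.div (by fun_prop) (by fun_prop) hP, ?_⟩
  have hr : ∀ w ∈ P.roots.map (· / ζ), ‖w‖ ≠ 1 := by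
    intro w hw h1
    obtain ⟨x, hx, rfl⟩ := Multiset.mem_map.1 hw
    -- A root `x` with `‖x / ζ‖ = 1` would lie on the circle, at the angle `arg (x / ζ)`.
    have := hP (arg (x / ζ))
    have h2 := norm_mul_exp_arg_mul_I (x / ζ)
    rw [h1, ofReal_one, one_mul] at h2
    rw [h2, mul_div_cancel₀ _ hζ] at this
    exact this (Polynomial.isRoot_of_mem_roots hx)
  have := (continuous_and_integral_multiset_sum_exp_div _ hr).2
  rw [Multiset.filter_map, Multiset.card_map] at this
  trans ∫ t in (0 : ℝ)..2 * Real.pi,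
      ((P.roots.map (· / ζ)).map fun w => exp (t * I) / (exp (t * I) - w)).sum
  · refine intervalIntegral.integral_congr fun t _ => ?_
    simp only [Multiset.map_map, Function.comp_def]
    -- `P' / P` is the sum of `1 / (x - w)` over the roots `w`; dividing by `ζ` moves each term to
    -- the unit circle.
    rw [mul_div_assoc, (IsAlgClosed.splits P).eval_derivative_div_eval_of_ne_zero (hP t),
      ← Multiset.sum_map_mul_left]
    congr 1
    refine Multiset.map_congr rfl fun w hw => ?_
    have h1 : exp (t * I) - w / ζ ≠ 0 :=
      exp_mul_I_sub_ne_zero (hr _ (Multiset.mem_map_of_mem _ hw)) t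
    have h2 : ζ * exp (t * I) - w ≠ 0 := by
      intro h
      apply h1
      rw [← sub_eq_zero.1 h]
      field_simp
      ring
    field_simp
  · rw [this]
    simp [div_lt_one hζ']

/-! ### The index as a winding number -/

lemma numerator_sum (h : LaurentPolynomial ℂ) {x : ℂ} (hx : x ≠ 0) :
    (h.coeff.sum fun e c => c * x ^ e) = x ^ minDeg h * (numerator h).eval x := by
  rw [numerator, Finsupp.sum, Finsupp.sum, Polynomial.eval_finsetSum, Finset.mul_sum]
  refine Finset.sum_congr rfl fun e he => ?_
  have hm : minDeg h ≤ e := by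
    rw [minDeg, dif_pos ⟨e, he⟩]
    exact Finset.min'_le _ _ he
  rw [Polynomial.eval_monomial, ← zpow_natCast, Int.toNat_of_nonneg (by omega), mul_left_comm,
    ← zpow_add₀ hx]
  congr 2
  ring

lemma numerator_euler_sum (h : LaurentPolynomial ℂ) {x : ℂ} (hx : x ≠ 0) :
    (h.coeff.sum fun e c => (e : ℂ) * (c * x ^ e)) = x ^ minDeg h *
      (minDeg h * (numerator h).eval x + x * (numerator h).derivative.eval x) := by
  rw [numerator, Finsupp.sum, Finsupp.sum, Polynomial.eval_finsetSum, Polynomial.derivative_sum,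
    Polynomial.eval_finsetSum, Finset.mul_sum, Finset.mul_sum, ← Finset.sum_add_distrib,
    Finset.mul_sum]
  refine Finset.sum_congr rfl fun e he => ?_
  have hm : minDeg h ≤ e := by
    rw [minDeg, dif_pos ⟨e, he⟩]
    exact Finset.min'_le _ _ he
  obtain ⟨k, hk⟩ := Int.eq_ofNat_of_zero_le (sub_nonneg.2 hm)
  have he' : e = minDeg h + k := by omega
  rw [hk]
  generalize minDeg h = m at he'
  subst he'
  generalize h.coeff (m + k) = c
  rw [Int.toNat_natCast, Polynomial.derivative_monomial,
    Polynomial.eval_monomial, Polynomial.eval_monomial,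
    zpow_add₀ hx, zpow_natCast]
  -- The derivative of a monomial has the truncated exponent `k - 1`, so `k = 0` is separate.
  cases k with
  | zero => simp; ring
  | succ k => push_cast; ring

/-- The constant term is the coefficient at the smallest exponent. Hence the condition `0 < ‖z‖` in
`rootCount` excludes no root. -/
lemma numerator_eval_zero_ne {h : LaurentPolynomial ℂ} (hh : h.coeff.support.Nonempty) :
    (numerator h).eval 0 ≠ 0 := by
  have hm : minDeg h = h.coeff.support.min' hh := by rw [minDeg, dif_pos hh]
  have hmem : minDeg h ∈ h.coeff.support := hm ▸ Finset.min'_mem _ hh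
  rw [numerator, Finsupp.sum, Polynomial.eval_finsetSum, Finset.sum_eq_single (minDeg h)]
  · simpa [Polynomial.eval_monomial] using hmem
  · intro e he hne
    have : minDeg h ≤ e := hm ▸ Finset.min'_le _ _ he
    rw [Polynomial.eval_monomial, zero_pow (by omega), mul_zero]
  · exact fun h => absurd hmem h

lemma restrict_sum {r : ℕ} (f : Laurent r) (ζ : Fin r → ℂˣ) (i : Fin r) (g : ℤ → ℂ) :
    ((restrict f ζ i).coeff.sum fun e c => g e * c) =
      f.coeff.sum fun e c => g (e i) * (c * ∏ j ∈ Finset.univ.erase i, (ζ j : ℂ) ^ e j) := by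
  rw [restrict, AddMonoidAlgebra.coeff_finsuppSum, Finsupp.sum_sum_index (by simp)
    (by intros; ring)]
  refine Finsupp.sum_congr fun e _ => ?_
  rw [AddMonoidAlgebra.coeff_single, Finsupp.sum_single_index (by simp)]

lemma prod_rotate {r : ℕ} (i : Fin r) (z : Fin r → ℂ) (t : ℝ) (e : Fin r → ℤ) :
    ∏ j, rotate i z t j ^ e j =
      (z i * exp (t * I)) ^ e i * ∏ j ∈ Finset.univ.erase i, z j ^ e j := by
  rw [← Finset.mul_prod_erase _ _ (Finset.mem_univ i)]
  congr 1
  · simp [rotate]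
  · refine Finset.prod_congr rfl fun j hj => ?_
    rw [rotate, Function.update_of_ne (Finset.ne_of_mem_erase hj)]

lemma value_rotate {r : ℕ} (f : Laurent r) (ζ : Fin r → ℂˣ) (i : Fin r) (t : ℝ) :
    value (rotate i (fun j => (ζ j : ℂ)) t) f =
      (restrict f ζ i).coeff.sum fun e c => c * ((ζ i : ℂ) * exp (t * I)) ^ e := by
  have := restrict_sum f ζ i fun e => ((ζ i : ℂ) * exp (t * I)) ^ e
  simp only [mul_comm (((ζ i : ℂ) * exp (t * I)) ^ (_ : ℤ))] at this
  rw [this, value]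
  refine Finsupp.sum_congr fun e _ => ?_
  rw [prod_rotate]
  ring

lemma eulerValue_rotate {r : ℕ} (f : Laurent r) (ζ : Fin r → ℂˣ) (i : Fin r) (t : ℝ) :
    eulerValue i (rotate i (fun j => (ζ j : ℂ)) t) f =
      (restrict f ζ i).coeff.sum fun e c => (e : ℂ) * (c * ((ζ i : ℂ) * exp (t * I)) ^ e) := by
  have := restrict_sum f ζ i fun e => (e : ℂ) * ((ζ i : ℂ) * exp (t * I)) ^ e
  trans (restrict f ζ i).coeff.sum fun e c => (e : ℂ) * ((ζ i : ℂ) * exp (t * I)) ^ e * c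
  · rw [this, eulerValue]
    refine Finsupp.sum_congr fun e _ => ?_
    rw [prod_rotate]
    ring
  · refine Finsupp.sum_congr fun e _ => ?_
    ring

/-- The index is the winding number. -/
lemma winding_eq_indexAt {r : ℕ} (f : Laurent r) (ζ : Fin r → ℂˣ) (i : Fin r)
    (hf : ∀ t : ℝ, value (rotate i (fun j => (ζ j : ℂ)) t) f ≠ 0) :
    winding i (fun j => (ζ j : ℂ)) f = indexAt f ζ i := by
  have hx (t : ℝ) : (ζ i : ℂ) * exp (t * I) ≠ 0 := mul_ne_zero (ζ i).ne_zero (exp_ne_zero _)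
  have hP (t : ℝ) : (numerator (restrict f ζ i)).eval ((ζ i : ℂ) * exp (t * I)) ≠ 0 := by
    have := hf t
    rw [value_rotate, numerator_sum _ (hx t)] at this
    exact right_ne_zero_of_mul this
  obtain ⟨hc, hi⟩ := integral_polynomial_logDeriv _ _ (ζ i).ne_zero hP
  have hne : (restrict f ζ i).coeff.support.Nonempty := by
    rw [Finset.nonempty_iff_ne_empty]
    intro h
    apply hP 0
    rw [numerator, Finsupp.sum, h]
    simp
  have h0 := numerator_eval_zero_ne hne
  have hroots : rootCount (restrict f ζ i) ‖(ζ i : ℂ)‖ =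
      ((numerator (restrict f ζ i)).roots.filter fun w => ‖w‖ < ‖(ζ i : ℂ)‖).card := by
    rw [rootCount]
    congr 1
    refine Multiset.filter_congr fun w hw => ?_
    rw [and_iff_right_iff_imp]
    intro _
    refine norm_pos_iff.2 ?_
    rintro rfl
    exact h0 (Polynomial.isRoot_of_mem_roots hw)
  have hpi : (2 * Real.pi : ℂ) ≠ 0 := by simp [Real.pi_ne_zero]
  have hint : ∫ t in (0 : ℝ)..2 * Real.pi,
      eulerValue i (rotate i (fun j => (ζ j : ℂ)) t) f / value (rotate i (fun j => (ζ j : ℂ)) t) f =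
      ∫ t in (0 : ℝ)..2 * Real.pi, ((minDeg (restrict f ζ i) : ℂ) + (ζ i : ℂ) * exp (t * I) *
        (numerator (restrict f ζ i)).derivative.eval ((ζ i : ℂ) * exp (t * I)) /
        (numerator (restrict f ζ i)).eval ((ζ i : ℂ) * exp (t * I))) := by
    refine intervalIntegral.integral_congr fun t _ => ?_
    rw [value_rotate, eulerValue_rotate, numerator_sum _ (hx t), numerator_euler_sum _ (hx t),
      mul_div_mul_left _ _ (zpow_ne_zero _ (hx t)), add_div, mul_div_cancel_right₀ _ (hP t)]
  rw [winding, hint, intervalIntegral.integral_add (by simp) (hc.intervalIntegrable _ _), hi,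
    intervalIntegral.integral_const, indexAt, hroots]
  simp only [sub_zero, real_smul, ofReal_mul, ofReal_ofNat]
  push_cast
  field_simp
  ring


/-! ### Deformation invariance and independence of the base point -/

/-- The points of `(ℂ*)^r` over the point `a` of `ℝ^r`. -/
def OnTorus {r : ℕ} (a : Fin r → ℝ) (z : Fin r → ℂ) : Prop :=
  ∀ j, ‖z j‖ = Real.exp (a j)

lemma OnTorus.ne_zero {r : ℕ} {a : Fin r → ℝ} {z : Fin r → ℂ} (hz : OnTorus a z) (j : Fin r) :
    z j ≠ 0 := by
  rw [← norm_pos_iff, hz j]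
  exact Real.exp_pos _

lemma OnTorus.rotate {r : ℕ} {a : Fin r → ℝ} {z : Fin r → ℂ} (hz : OnTorus a z) (i : Fin r)
    (t : ℝ) : OnTorus a (rotate i z t) := by
  intro j
  by_cases h : j = i
  · subst h
    simp [LopsidedAmoeba.rotate, hz j, norm_exp_ofReal_mul_I]
  · simp [LopsidedAmoeba.rotate, h, hz j]

lemma OnTorus.mul {r : ℕ} {a : Fin r → ℝ} {z : Fin r → ℂ} (hz : OnTorus a z) {u : Fin r → ℂ}
    (hu : ∀ j, ‖u j‖ = 1) : OnTorus a (fun j => u j * z j) := by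
  intro j
  rw [norm_mul, hu, one_mul, hz j]

lemma OnTorus.log_eq {r : ℕ} {a : Fin r → ℝ} {ζ : Fin r → ℂˣ} (h : OnTorus a fun j => (ζ j : ℂ)) :
    Log ζ = a := by
  ext j
  rw [Log, h j, Real.log_exp]

lemma onTorus_of_log_eq {r : ℕ} {a : Fin r → ℝ} {ζ : Fin r → ℂˣ} (h : Log ζ = a) :
    OnTorus a fun j => (ζ j : ℂ) := by
  intro j
  rw [← h, Log, Real.exp_log (norm_pos_iff.2 (ζ j).ne_zero)]

lemma onTorus_expPoint {r : ℕ} (a : Fin r → ℝ) : OnTorus a fun j => (expPoint a j : ℂ) := by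
  intro j
  simp [expPoint, norm_exp]

lemma value_ne_zero_of_notMem_amoeba {r : ℕ} {f : Laurent r} {a : Fin r → ℝ} (ha : a ∉ amoeba f)
    {z : Fin r → ℂ} (hz : OnTorus a z) : value z f ≠ 0 := by
  intro h
  refine ha ⟨fun j => Units.mk0 (z j) (hz.ne_zero j), h, OnTorus.log_eq hz⟩

lemma winding_mem_int {r : ℕ} {f : Laurent r} {a : Fin r → ℝ}
    (hf : ∀ z, OnTorus a z → value z f ≠ 0) {z : Fin r → ℂ} (hz : OnTorus a z) (i : Fin r) :
    ∃ n : ℤ, winding i z f = n :=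
  ⟨_, winding_eq_indexAt f (fun j => Units.mk0 (z j) (hz.ne_zero j)) i
    fun t => hf _ (hz.rotate i t)⟩

/-- A continuous integer-valued function on a preconnected space is constant; continuity comes from
that of parametric integrals. -/
lemma average_constant {X : Type*} [TopologicalSpace X] [PreconnectedSpace X] {F : X → ℝ → ℂ}
    (hF : Continuous F.uncurry)
    (hint : ∀ x, ∃ n : ℤ, (2 * Real.pi : ℂ)⁻¹ * ∫ t in (0 : ℝ)..2 * Real.pi, F x t = n) (x y : X) :
    (2 * Real.pi : ℂ)⁻¹ * ∫ t in (0 : ℝ)..2 * Real.pi, F x t =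
      (2 * Real.pi : ℂ)⁻¹ * ∫ t in (0 : ℝ)..2 * Real.pi, F y t := by
  choose n hn using hint
  have hc : Continuous fun x => (2 * Real.pi : ℂ)⁻¹ * ∫ t in (0 : ℝ)..2 * Real.pi, F x t :=
    continuous_const.mul (continuous_parametric_intervalIntegral_of_continuous' hF _ _)
  have hn' : Continuous n := by
    rw [Int.isClosedEmbedding_coe_real.isEmbedding.continuous_iff]
    convert continuous_re.comp hc using 1
    ext x
    simp only [Function.comp_apply, hn, intCast_re]
  rw [hn, hn, PreconnectedSpace.constant ‹_› hn']

section Continuity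

variable {r : ℕ} {X : Type*} [TopologicalSpace X] {z : X → Fin r → ℂ}

lemma continuous_prod_zpow (hz : Continuous z) (h0 : ∀ x j, z x j ≠ 0) (e : Fin r → ℤ) :
    Continuous fun x => ∏ j, z x j ^ e j :=
  continuous_finsetProd _ fun j _ =>
    ((continuous_apply j).comp hz).zpow₀ _ fun x => Or.inl (h0 x j)

lemma continuous_value (hz : Continuous z) (h0 : ∀ x j, z x j ≠ 0) (f : Laurent r) :
    Continuous fun x => value (z x) f :=
  continuous_finsetSum _ fun e _ => continuous_const.mul (continuous_prod_zpow hz h0 e)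

lemma continuous_eulerValue (hz : Continuous z) (h0 : ∀ x j, z x j ≠ 0) (i : Fin r)
    (f : Laurent r) : Continuous fun x => eulerValue i (z x) f :=
  continuous_finsetSum _ fun e _ =>
    continuous_const.mul (continuous_const.mul (continuous_prod_zpow hz h0 e))

lemma continuous_rotate (hz : Continuous z) (i : Fin r) :
    Continuous fun p : X × ℝ => rotate i (z p.1) p.2 := by
  refine (hz.comp continuous_fst).update i ?_
  have : Continuous fun p : X × ℝ => z p.1 i := (continuous_apply i).comp (hz.comp continuous_fst)
  fun_prop

end Continuity

lemma continuous_logDeriv_rotate {r : ℕ} {f : Laurent r} {a : Fin r → ℝ}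
    (hf : ∀ z, OnTorus a z → value z f ≠ 0) {X : Type*} [TopologicalSpace X]
    {z : X → Fin r → ℂ} (hz : Continuous z) (hza : ∀ x, OnTorus a (z x)) (i : Fin r) :
    Continuous fun p : X × ℝ =>
      eulerValue i (rotate i (z p.1) p.2) f / value (rotate i (z p.1) p.2) f := by
  have hr := continuous_rotate hz i
  have h0 (p : X × ℝ) (j : Fin r) : rotate i (z p.1) p.2 j ≠ 0 := ((hza p.1).rotate i p.2).ne_zero j
  exact (continuous_eulerValue hr h0 i f).div (continuous_value hr h0 f)
    fun p => hf _ ((hza p.1).rotate i p.2)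

lemma continuous_logDeriv_rotate_apply {r : ℕ} {f : Laurent r} {a : Fin r → ℝ}
    (hf : ∀ z, OnTorus a z → value z f ≠ 0) {z : Fin r → ℂ} (hz : OnTorus a z) (i : Fin r) :
    Continuous fun t : ℝ => eulerValue i (rotate i z t) f / value (rotate i z t) f := by
  have hr : Continuous fun t : ℝ => rotate i z t :=
    (continuous_const (y := z)).update i (by fun_prop)
  have h0 (t : ℝ) (j : Fin r) : rotate i z t j ≠ 0 := (hz.rotate i t).ne_zero j
  exact (continuous_eulerValue hr h0 i f).div (continuous_value hr h0 f)
    fun t => hf _ (hz.rotate i t)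

lemma winding_constant_on_torus {r : ℕ} {f : Laurent r} {a : Fin r → ℝ}
    (hf : ∀ z, OnTorus a z → value z f ≠ 0) {z : Fin r → ℂ} (hz : OnTorus a z) (i : Fin r) :
    winding i z f = winding i (fun j => (expPoint a j : ℂ)) f := by
  -- Scaling all arguments by `s` joins the positive real point (`s = 0`) to `z` (`s = 1`) inside
  -- the torus.
  let γ : ℝ → Fin r → ℂ := fun s j => exp (a j) * exp ((s * arg (z j) : ℝ) * I)
  have hγ : Continuous γ := by
    refine continuous_pi fun j => ?_
    simp only [γ]
    fun_prop
  have hγa (s : ℝ) : OnTorus a (γ s) := fun j => by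
    simp only [γ, norm_mul, norm_exp_ofReal_mul_I, mul_one, ← ofReal_exp, norm_real, Real.norm_eq_abs,
      Real.abs_exp]
  have h0 : γ 0 = fun j => (expPoint a j : ℂ) := by
    ext j
    simp [γ, expPoint]
  have h1 : γ 1 = z := by
    ext j
    simp only [γ, one_mul]
    rw [← ofReal_exp, ← hz j, norm_mul_exp_arg_mul_I]
  rw [← h0, ← h1]
  exact average_constant (F := fun s t => eulerValue i (rotate i (γ s) t) f /
    value (rotate i (γ s) t) f) (continuous_logDeriv_rotate hf hγ hγa i)
    (fun s => winding_mem_int hf (hγa s) i) 1 0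

/-! ### Products, rescaling and the winding number of `f_n` -/

section Algebra

variable {r : ℕ} (z : Fin r → ℂ) (i : Fin r)

@[simp] lemma value_zero : value z (0 : Laurent r) = 0 := by simp [value]

@[simp] lemma eulerValue_zero : eulerValue i z (0 : Laurent r) = 0 := by simp [eulerValue]

lemma value_add (f g : Laurent r) : value z (f + g) = value z f + value z g :=
  Finsupp.sum_add_index' (by simp) (by intros; ring)

lemma eulerValue_add (f g : Laurent r) :
    eulerValue i z (f + g) = eulerValue i z f + eulerValue i z g :=
  Finsupp.sum_add_index' (by simp) (by intros; ring)

lemma value_single (e : Fin r → ℤ) (c : ℂ) :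
    value z (AddMonoidAlgebra.single e c) = c * ∏ j, z j ^ e j :=
  Finsupp.sum_single_index (by simp)

lemma eulerValue_single (e : Fin r → ℤ) (c : ℂ) :
    eulerValue i z (AddMonoidAlgebra.single e c) = e i * (c * ∏ j, z j ^ e j) :=
  Finsupp.sum_single_index (by simp)

lemma value_smul (s : ℂ) (f : Laurent r) : value z (s • f) = s * value z f := by
  rw [value, value, AddMonoidAlgebra.coeff_smul, Finsupp.sum_smul_index (by simp), Finsupp.mul_sum]
  refine Finsupp.sum_congr fun e _ => by ring

lemma eulerValue_smul (s : ℂ) (f : Laurent r) :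
    eulerValue i z (s • f) = s * eulerValue i z f := by
  rw [eulerValue, eulerValue, AddMonoidAlgebra.coeff_smul, Finsupp.sum_smul_index (by simp),
    Finsupp.mul_sum]
  refine Finsupp.sum_congr fun e _ => by ring

variable {z}

lemma value_mul (hz : ∀ j, z j ≠ 0) (f g : Laurent r) : value z (f * g) = value z f * value z g := by
  induction f using AddMonoidAlgebra.induction_linear with
  | zero => simp
  | add f₁ f₂ h₁ h₂ => rw [add_mul, value_add, value_add, h₁, h₂, add_mul]
  | single e c =>
    induction g using AddMonoidAlgebra.induction_linear with
    | zero => simp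
    | add f₁ f₂ h₁ h₂ => rw [mul_add, value_add, value_add, h₁, h₂, mul_add]
    | single e' c' =>
      rw [AddMonoidAlgebra.single_mul_single, value_single, value_single, value_single]
      simp only [Pi.add_apply, zpow_add₀ (hz _), Finset.prod_mul_distrib]
      ring

lemma eulerValue_mul (hz : ∀ j, z j ≠ 0) (f g : Laurent r) :
    eulerValue i z (f * g) = eulerValue i z f * value z g + value z f * eulerValue i z g := by
  induction f using AddMonoidAlgebra.induction_linear with
  | zero => simp
  | add f₁ f₂ h₁ h₂ => rw [add_mul, value_add, eulerValue_add, eulerValue_add, h₁, h₂]; ring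
  | single e c =>
    induction g using AddMonoidAlgebra.induction_linear with
    | zero => simp
    | add f₁ f₂ h₁ h₂ => rw [mul_add, value_add, eulerValue_add, eulerValue_add, h₁, h₂]; ring
    | single e' c' =>
      simp only [AddMonoidAlgebra.single_mul_single, value_single, eulerValue_single,
        Pi.add_apply, zpow_add₀ (hz _), Finset.prod_mul_distrib]
      push_cast
      ring

lemma logDeriv_prod (hz : ∀ j, z j ≠ 0) {κ : Type*} (s : Finset κ) (F : κ → Laurent r)
    (hF : ∀ k ∈ s, value z (F k) ≠ 0) :
    value z (∏ k ∈ s, F k) ≠ 0 ∧ eulerValue i z (∏ k ∈ s, F k) / value z (∏ k ∈ s, F k) =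
      ∑ k ∈ s, eulerValue i z (F k) / value z (F k) := by
  classical
  induction s using Finset.induction_on with
  | empty => simp [AddMonoidAlgebra.one_def, value_single, eulerValue_single]
  | insert k s hk ih =>
    obtain ⟨h1, h2⟩ := ih fun k hk => hF k (Finset.mem_insert_of_mem hk)
    have h3 := hF k (Finset.mem_insert_self k s)
    rw [Finset.prod_insert hk, Finset.sum_insert hk, value_mul hz, eulerValue_mul i hz, ← h2]
    refine ⟨mul_ne_zero h3 h1, ?_⟩
    field_simp

lemma value_rescale (u : Fin r → ℂˣ) (f : Laurent r) :
    value z (rescale u f) = value (fun j => (u j : ℂ) * z j) f := by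
  rw [value, rescale, AddMonoidAlgebra.coeff_finsuppSum, Finsupp.sum_sum_index (by simp)
    (by intros; ring), value]
  refine Finsupp.sum_congr fun e _ => ?_
  rw [AddMonoidAlgebra.coeff_single, Finsupp.sum_single_index (by simp)]
  simp only [mul_zpow, Finset.prod_mul_distrib]
  ring

lemma eulerValue_rescale (u : Fin r → ℂˣ) (f : Laurent r) :
    eulerValue i z (rescale u f) = eulerValue i (fun j => (u j : ℂ) * z j) f := by
  rw [eulerValue, rescale, AddMonoidAlgebra.coeff_finsuppSum, Finsupp.sum_sum_index (by simp)
    (by intros; ring), eulerValue]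
  refine Finsupp.sum_congr fun e _ => ?_
  rw [AddMonoidAlgebra.coeff_single, Finsupp.sum_single_index (by simp)]
  simp only [mul_zpow, Finset.prod_mul_distrib]
  ring

lemma mul_rotate (u : Fin r → ℂˣ) (t : ℝ) :
    (fun j => (u j : ℂ) * rotate i z t j) = rotate i (fun j => (u j : ℂ) * z j) t := by
  ext j
  by_cases h : j = i
  · subst h
    simp [rotate, mul_assoc]
  · simp [rotate, h]

lemma winding_rescale (u : Fin r → ℂˣ) (f : Laurent r) :
    winding i z (rescale u f) = winding i (fun j => (u j : ℂ) * z j) f := by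
  simp only [winding, value_rescale, eulerValue_rescale, mul_rotate]

end Algebra

lemma norm_rootOfUnity (n k : ℕ) : ‖(rootOfUnity n k : ℂ)‖ = 1 := by
  have : 2 * (Real.pi : ℂ) * I * k / n = ((2 * Real.pi * k / n : ℝ) : ℂ) * I := by
    push_cast
    ring
  rw [rootOfUnity, Units.val_mk0, this, norm_exp_ofReal_mul_I]

lemma value_rescale_rootOfUnity_ne_zero {r : ℕ} {f : Laurent r} {a : Fin r → ℝ}
    (hf : ∀ z, OnTorus a z → value z f ≠ 0) {n : ℕ} (k : Fin r → Fin n) (z : Fin r → ℂ)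
    (hz : OnTorus a z) : value z (rescale (fun j => rootOfUnity n (k j)) f) ≠ 0 := by
  rw [value_rescale]
  exact hf _ (hz.mul fun j => norm_rootOfUnity _ _)

/-- Each rescaling by roots of unity only moves the base point along the torus, so all `n ^ r`
factors contribute the same winding number. -/
lemma winding_cyclicResultant {r : ℕ} {f : Laurent r} {a : Fin r → ℝ}
    (hf : ∀ z, OnTorus a z → value z f ≠ 0) (n : ℕ) (i : Fin r) :
    winding i (fun j => (expPoint a j : ℂ)) (cyclicResultant n f) =
      n ^ r * winding i (fun j => (expPoint a j : ℂ)) f := by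
  have hz := onTorus_expPoint a
  have hk (k : Fin r → Fin n) (w : Fin r → ℂ) (hw : OnTorus a w) :
      value w (rescale (fun j => rootOfUnity n (k j)) f) ≠ 0 :=
    value_rescale_rootOfUnity_ne_zero hf k w hw
  have hsum : winding i (fun j => (expPoint a j : ℂ)) (cyclicResultant n f) =
      ∑ k : Fin r → Fin n, winding i (fun j => (expPoint a j : ℂ))
        (rescale (fun j => rootOfUnity n (k j)) f) := by
    simp only [winding]
    rw [← Finset.mul_sum, ← intervalIntegral.integral_finsetSum]
    · congr 1
      refine intervalIntegral.integral_congr fun t _ => ?_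
      exact (logDeriv_prod i (hz.rotate i t).ne_zero Finset.univ
        (fun k : Fin r → Fin n => rescale (fun j => rootOfUnity n (k j)) f)
        fun k _ => hk k _ (hz.rotate i t)).2
    · intro k _
      exact (continuous_logDeriv_rotate_apply (hk k) hz i).intervalIntegrable _ _
  rw [hsum, Finset.sum_congr rfl fun k _ => (winding_rescale i _ f).trans
    (winding_constant_on_torus hf (hz.mul fun j => norm_rootOfUnity _ _) i)]
  simp

/-! ### Dominant monomials -/

lemma norm_monomial {r : ℕ} {a : Fin r → ℝ} {z : Fin r → ℂ} (hz : OnTorus a z) (g : Laurent r)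
    (e : Fin r → ℤ) : ‖g.coeff e * ∏ j, z j ^ e j‖ = monomialAbs g a e := by
  rw [norm_mul, norm_prod, monomialAbs]
  simp only [norm_zpow, hz _]

lemma norm_value_erase_lt {r : ℕ} {g : Laurent r} {a : Fin r → ℝ} {e : Fin r → ℤ}
    (hg : IsDominant g a e) {z : Fin r → ℂ} (hz : OnTorus a z) :
    ‖value z (g.erase e)‖ < ‖g.coeff e * ∏ j, z j ^ e j‖ := by
  rw [norm_monomial hz]
  refine lt_of_le_of_lt ?_ hg.2
  rw [value, AddMonoidAlgebra.coeff_erase, Finsupp.sum, Finsupp.support_erase]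
  refine (norm_sum_le _ _).trans_eq (Finset.sum_congr rfl fun e' he' => ?_)
  rw [Finsupp.erase_ne (Finset.ne_of_mem_erase he'), norm_monomial hz]

/-- The winding number of a Laurent polynomial with a dominant monomial is the exponent of that
monomial. -/
lemma winding_of_isDominant {r : ℕ} {g : Laurent r} {a : Fin r → ℝ} {e : Fin r → ℤ}
    (hg : IsDominant g a e) {z : Fin r → ℂ} (hz : OnTorus a z) (i : Fin r) :
    winding i z g = e i := by
  -- Linear homotopy from the dominant monomial (`s = 0`) to `g` (`s = 1`).
  let G : unitInterval → Laurent r := fun s =>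
    AddMonoidAlgebra.single e (g.coeff e) + ((s : ℝ) : ℂ) • g.erase e
  have hG (s : unitInterval) (w : Fin r → ℂ) (hw : OnTorus a w) : value w (G s) ≠ 0 := by
    intro h
    rw [value_add, value_smul, value_single] at h
    have h1 := norm_value_erase_lt hg hw
    -- At a zero the dominant term would have norm `s` times that of the rest, with `s ≤ 1`.
    rw [eq_neg_of_add_eq_zero_left h, norm_neg, norm_mul, norm_real, Real.norm_eq_abs,
      abs_of_nonneg s.2.1] at h1
    exact absurd h1 (not_lt.2 (mul_le_of_le_one_left (norm_nonneg _) s.2.2))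
  have hr : Continuous fun p : unitInterval × ℝ => rotate i z p.2 :=
    continuous_rotate (z := fun _ => z) continuous_const i
  have h0 (p : unitInterval × ℝ) (j : Fin r) : rotate i z p.2 j ≠ 0 := (hz.rotate i p.2).ne_zero j
  have hs : Continuous fun p : unitInterval × ℝ => (((p.1 : unitInterval) : ℝ) : ℂ) := by fun_prop
  have hcont : Continuous fun p : unitInterval × ℝ =>
      eulerValue i (rotate i z p.2) (G p.1) / value (rotate i z p.2) (G p.1) := by
    refine Continuous.div ?_ ?_ fun p => hG _ _ (hz.rotate i p.2)
    · simp only [G, eulerValue_add, eulerValue_smul]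
      exact (continuous_eulerValue hr h0 i _).add (hs.mul (continuous_eulerValue hr h0 i _))
    · simp only [G, value_add, value_smul]
      exact (continuous_value hr h0 _).add (hs.mul (continuous_value hr h0 _))
  have key : winding i z (G 1) = winding i z (G 0) :=
    average_constant (F := fun s t => eulerValue i (rotate i z t) (G s) /
      value (rotate i z t) (G s)) hcont (fun s => winding_mem_int (hG s) hz i) 1 0
  have h1 : G 1 = g := by simp [G, AddMonoidAlgebra.single_add_erase]
  rw [h1] at key
  rw [key, winding]
  have hint : ∫ t in (0 : ℝ)..2 * Real.pi,
      eulerValue i (rotate i z t) (G 0) / value (rotate i z t) (G 0) =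
        ∫ t in (0 : ℝ)..2 * Real.pi, (e i : ℂ) := by
    refine intervalIntegral.integral_congr fun t _ => ?_
    have h2 := hG 0 _ (hz.rotate i t)
    simp only [G, Set.Icc.coe_zero, ofReal_zero, zero_smul, add_zero, value_single,
      eulerValue_single] at h2 ⊢
    exact mul_div_cancel_right₀ _ h2
  have hpi : (Real.pi : ℂ) ≠ 0 := by simp [Real.pi_ne_zero]
  rw [hint, intervalIntegral.integral_const]
  simp only [sub_zero, real_smul, ofReal_mul, ofReal_ofNat]
  field_simp

lemma IsLopsided.exists_isDominant {r : ℕ} {g : Laurent r} {a : Fin r → ℝ}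
    (h : IsLopsided (absList g a)) : ∃ e, IsDominant g a e := by
  obtain ⟨b, hb, hlt⟩ := h
  obtain ⟨e, he, rfl⟩ := Multiset.mem_map.1 hb
  refine ⟨e, he, ?_⟩
  have : absList g a =
      monomialAbs g a e ::ₘ (g.coeff.support.erase e).val.map (monomialAbs g a) := by
    rw [absList, ← Multiset.map_cons, Finset.erase_val, Multiset.cons_erase he]
  rw [this, Multiset.erase_cons_head] at hlt
  exact hlt

/-! ### Exponents of `f_n` and the Newton polytope -/

lemma exists_sum_of_mem_support_prod {r : ℕ} (f : Laurent r) {κ : Type*} (s : Finset κ)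
    (F : κ → Laurent r) (hF : ∀ k, (F k).coeff.support ⊆ f.coeff.support) (e : Fin r → ℤ)
    (he : e ∈ (∏ k ∈ s, F k).coeff.support) :
    ∃ x : κ → Fin r → ℤ, (∀ k ∈ s, x k ∈ f.coeff.support) ∧ e = ∑ k ∈ s, x k := by
  classical
  induction s using Finset.induction_on generalizing e with
  | empty =>
    refine ⟨fun _ => 0, by simp, ?_⟩
    rw [Finset.prod_empty, AddMonoidAlgebra.one_def, AddMonoidAlgebra.coeff_single] at he
    simpa using Finsupp.support_single_subset he
  | insert k s hk ih =>
    rw [Finset.prod_insert hk] at he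
    obtain ⟨y, hy, w, hw, rfl⟩ := Finset.mem_add.1 (AddMonoidAlgebra.support_coeff_mul_subset _ _ he)
    obtain ⟨x, hx, rfl⟩ := ih w hw
    refine ⟨Function.update x k y, fun l hl => ?_, ?_⟩
    · rcases Finset.mem_insert.1 hl with rfl | hl
      · simpa using hF _ hy
      · rw [Function.update_of_ne (ne_of_mem_of_not_mem hl hk)]
        exact hx l hl
    · rw [Finset.sum_insert hk, Function.update_self]
      congr 1
      exact Finset.sum_congr rfl fun l hl => by
        rw [Function.update_of_ne (ne_of_mem_of_not_mem hl hk)]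

lemma support_rescale_subset {r : ℕ} (u : Fin r → ℂˣ) (f : Laurent r) :
    (rescale u f).coeff.support ⊆ f.coeff.support := by
  classical
  rw [rescale, AddMonoidAlgebra.coeff_finsuppSum]
  refine Finsupp.support_sum.trans fun e he => ?_
  obtain ⟨e', he', h⟩ := Finset.mem_biUnion.1 he
  rw [AddMonoidAlgebra.coeff_single] at h
  rwa [Finset.mem_singleton.1 (Finsupp.support_single_subset h)]

lemma mem_newtonPolytope_of_mem_support {r : ℕ} (f : Laurent r) {n : ℕ} (hn : 0 < n)
    (k : Fin r → ℤ)
    (hk : (fun i => (n : ℤ) ^ r * k i) ∈ (cyclicResultant n f).coeff.support) :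
    (fun i => (k i : ℝ)) ∈ newtonPolytope f := by
  obtain ⟨x, hx, he⟩ := exists_sum_of_mem_support_prod f _ _
    (fun _ => support_rescale_subset _ f) _ hk
  have hn' : (n : ℝ) ^ r ≠ 0 := by positivity
  have heq : (fun i => (k i : ℝ)) =
      ∑ l : Fin r → Fin n, ((n : ℝ) ^ r)⁻¹ • (fun i => (x l i : ℝ)) := by
    ext i
    have h := congrArg (Int.cast : ℤ → ℝ) (congrFun he i)
    rw [Finset.sum_apply] at h ⊢
    push_cast at h
    simp only [Pi.smul_apply, smul_eq_mul]
    rw [← Finset.mul_sum, ← h, inv_mul_cancel_left₀ hn']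
  rw [heq]
  -- The equal weights `(n ^ r)⁻¹` sum to one because there are `n ^ r` tuples `l`.
  refine (convex_convexHull ℝ _).sum_mem (fun _ _ => by positivity) ?_ fun l hl =>
    subset_convexHull ℝ _ ⟨x l, hx l hl, rfl⟩
  simp [hn']

end LopsidedAmoeba

theorem mainTheorem6 (r : ℕ) (f : LopsidedAmoeba.Laurent r) (a : Fin r → ℝ)
    (ha : a ∉ LopsidedAmoeba.amoeba f) :
    (∀ ζ : Fin r → ℂˣ, LopsidedAmoeba.Log ζ = a →
      LopsidedAmoeba.indexAt f ζ = LopsidedAmoeba.ind f a) ∧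
    ∀ n : ℕ, 0 < n →
      LopsidedAmoeba.IsLopsided
        (LopsidedAmoeba.absList (LopsidedAmoeba.cyclicResultant n f) a) →
      (fun i => (LopsidedAmoeba.ind f a i : ℝ)) ∈ LopsidedAmoeba.newtonPolytope f ∧
      LopsidedAmoeba.IsDominant (LopsidedAmoeba.cyclicResultant n f) a
        (fun i => (n : ℤ) ^ r * LopsidedAmoeba.ind f a i) := by
  open LopsidedAmoeba in
  have hf : ∀ z, OnTorus a z → value z f ≠ 0 := fun z hz => value_ne_zero_of_notMem_amoeba ha hz
  have hw (ζ : Fin r → ℂˣ) (hζ : OnTorus a fun j => (ζ j : ℂ)) (i : Fin r) :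
      winding i (fun j => (ζ j : ℂ)) f = indexAt f ζ i :=
    winding_eq_indexAt f ζ i fun t => hf _ (hζ.rotate i t)
  have hexp := onTorus_expPoint a
  refine ⟨fun ζ hζ => ?_, fun n hn hl => ?_⟩
  · have hζ' := onTorus_of_log_eq hζ
    ext i
    have := winding_constant_on_torus hf hζ' i
    rw [hw ζ hζ', hw _ hexp] at this
    exact_mod_cast this
  · obtain ⟨e, he⟩ := hl.exists_isDominant
    have hee : e = fun i => (n : ℤ) ^ r * ind f a i := by
      ext i
      have := winding_of_isDominant he hexp i
      -- Two evaluations of the winding number of `f_n` at the positive real point are compared.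
      rw [winding_cyclicResultant hf, hw _ hexp] at this
      exact_mod_cast this.symm
    rw [hee] at he
    exact ⟨mem_newtonPolytope_of_mem_support f hn _ he.1, he⟩
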